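/- For complex $a,q$ and an integer $m\ge 0$ put $(a;q)_m=\prod_{j=0}^{m-1}(1-aq^j)$, and for $|q|<1$ put $(a;q)_\infty=\prod_{j=0}^{\infty}(1-aq^j)$ and $(a_1,a_2,a_3;q)_\infty=(a_1;q)_\infty(a_2;q)_\infty(a_3;q)_\infty$. Let $q\in\mathbb{C}$ with $|q|<1$. Then the following four double series, summed over all integers $n,r\ge 0$, converge absolutely, and $$\sum_{n,r\ge 0}\frac{(-1)^n q^{3n^2+4n+4nr+\frac52 r^2+\frac72 r}}{(-q;q)_{2n+2r+2}\,(q;q)_r\,(q;q^2)_{r+1}\,(q^2;q^2)_n}=\frac{(q^2,q^{16},q^{18};q^{18})_\infty}{(q^2;q^2)_\infty},$$ $$\sum_{n,r\ge 0}\frac{(-1)^n q^{3n^2+4n+4nr+\frac52 r^2+\frac32 r}\,\bigl(q^{2r+2}-q+q^r+q^{r+1}\bigr)}{(-q;q)_{2n+2r+2}\,(q;q)_r\,(q;q^2)_{r+1}\,(q^2;q^2)_n}=\frac{(q^4,q^{14},q^{18};q^{18})_\infty}{(q^2;q^2)_\infty},$$ $$\sum_{n,r\ge 0}\frac{(-1)^n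 q^{3n^2+4nr+\frac52 r^2-\frac52 r}\,\bigl(q^{r}+q^{r+1}-q\bigr)}{(-q;q)_{2n+2r}\,(q;q)_r\,(q;q^2)_{r}\,(q^2;q^2)_n}=\frac{(q^6;q^6)_\infty}{(q^2;q^2)_\infty},$$ $$\sum_{n,r\ge 0}\frac{(-1)^n q^{3n^2+4nr+\frac52 r^2-\frac12 r}}{(-q;q)_{2n+2r}\,(q;q)_r\,(q;q^2)_{r}\,(q^2;q^2)_n}=\frac{(q^8,q^{10},q^{18};q^{18})_\infty}{(q^2;q^2)_\infty}.$$ -/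

import Mathlib

/-- The finite q-shifted factorial `(a;q)_m = ∏_{j=0}^{m-1} (1 - a q^j)`. -/
noncomputable def qPoch (a q : ℂ) (m : ℕ) : ℂ :=
  ∏ j ∈ Finset.range m, (1 - a * q ^ j)

/-- The infinite q-shifted factorial `(a;q)_∞ = ∏_{j≥0} (1 - a q^j)`. -/
noncomputable def qPochInf (a q : ℂ) : ℂ :=
  ∏' j : ℕ, (1 - a * q ^ j)

/-- `(a₁,a₂,a₃;q)_∞ = (a₁;q)_∞ (a₂;q)_∞ (a₃;q)_∞`. -/
noncomputable def qPochInf₃ (a₁ a₂ a₃ q : ℂ) : ℂ :=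
  qPochInf a₁ q * qPochInf a₂ q * qPochInf a₃ q

/-- For `|q| < 1` the infinite product defining `(a;q)_∞` converges. -/
theorem qPochInf_multipliable (a q : ℂ) (hq : ‖q‖ < 1) :
    Multipliable (fun j : ℕ => 1 - a * q ^ j) := by
  have h : Summable (fun j : ℕ => ‖-(a * q ^ j)‖) := by
    simpa [norm_mul, norm_pow] using
      (summable_geometric_of_lt_one (norm_nonneg q) hq).mul_left ‖a‖
  simpa [sub_eq_add_neg] using multipliable_one_add_of_summable h

open Filter Topology

/-! ### Finite and infinite `q`-shifted factorials -/

/-! All four series are one Bailey transform applied to four Bailey pairs. Suppose β_r = ∑_i c_i /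
((q;q)_{r-2i} (q;q)_{r+2i+s}) over i ∈ ℤ, where reciprocals at negative indices are 0. Weight β_r by
(-1)^n q^{n²} q^{2(N²+sN)} / ((q²;q²)_n (-q;q)_{2N+s}) with N = n + r, and sum over n and r.

For fixed N, a terminating q-Chu–Vandermonde sum (`qVandermonde`, used in
`sum_antidiagonal_change_base`) turns the convolution over n + r = N into (-q;q)_{2N+s} /
((q²;q²)_{N-2i} (q²;q²)_{N+2i+s}). The base is now q² and the factor (-q;q)_{2N+s} cancels. The sum
over N is then the Durfee rectangle identity in base q² (`hasSum_durfee_int`). What remains is ∑_i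
c_i q^{2((2i)²+2si)} / (q²;q²)_∞; this is `hasSum_bailey`.

The c_i are symmetrised versions of (-1)^i q^{i²-ki} with k = 1 or 3, and s = 0 or 2. The remaining
series is therefore a theta series with quadratic term 9i², and the Jacobi triple product gives the
modulus 18. The closed forms of β_r for k = 1 come from telescoping recurrences in r; those for k =
3 are combinations of the k = 1 sums at r and r - 1. -/

theorem qPoch_zero (a q : ℂ) : qPoch a q 0 = 1 := by simp [qPoch]

theorem qPoch_succ (a q : ℂ) (n : ℕ) : qPoch a q (n + 1) = qPoch a q n * (1 - a * q ^ n) := by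
  simp [qPoch, Finset.prod_range_succ]

theorem qPoch_add (a q : ℂ) (m n : ℕ) :
    qPoch a q (m + n) = qPoch a q m * qPoch (a * q ^ m) q n := by
  simp [qPoch, Finset.prod_range_add, pow_add, mul_assoc]

theorem one_sub_mul_pow_ne_zero {a q : ℂ} (ha : ‖a‖ < 1) (hq : ‖q‖ < 1) (n : ℕ) :
    1 - a * q ^ n ≠ 0 := by
  intro h
  have h1 : ‖a * q ^ n‖ = 1 := by rw [← sub_eq_zero.1 h]; simp
  rw [norm_mul, norm_pow] at h1
  have := mul_le_of_le_one_right (norm_nonneg a) (pow_le_one₀ (n := n) (norm_nonneg q) hq.le)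
  linarith

theorem qPoch_ne_zero {a q : ℂ} (ha : ‖a‖ < 1) (hq : ‖q‖ < 1) (n : ℕ) : qPoch a q n ≠ 0 :=
  Finset.prod_ne_zero_iff.2 fun j _ => one_sub_mul_pow_ne_zero ha hq j

theorem tendsto_qPoch (a : ℂ) {q : ℂ} (hq : ‖q‖ < 1) :
    Tendsto (qPoch a q) atTop (𝓝 (qPochInf a q)) :=
  (qPochInf_multipliable a q hq).hasProd.tendsto_prod_nat

theorem qPochInf_ne_zero {a q : ℂ} (ha : ‖a‖ < 1) (hq : ‖q‖ < 1) : qPochInf a q ≠ 0 := by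
  have h : Summable (fun j : ℕ => ‖-(a * q ^ j)‖) := by
    simpa [norm_mul, norm_pow] using
      (summable_geometric_of_lt_one (norm_nonneg q) hq).mul_left ‖a‖
  have := tprod_one_add_ne_zero_of_summable (f := fun j : ℕ => -(a * q ^ j))
    (fun j => by simpa [sub_eq_add_neg] using one_sub_mul_pow_ne_zero ha hq j) h
  simpa [qPochInf, sub_eq_add_neg] using this

theorem exists_norm_inv_qPoch_le {a q : ℂ} (ha : ‖a‖ < 1) (hq : ‖q‖ < 1) :
    ∃ C, ∀ n, ‖(qPoch a q n)⁻¹‖ ≤ C := by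
  have h := (tendsto_qPoch a hq).inv₀ (qPochInf_ne_zero ha hq)
  obtain ⟨C, hC⟩ := (Metric.isBounded_range_of_tendsto _ h).exists_norm_le
  exact ⟨C, fun n => hC _ ⟨n, rfl⟩⟩

/-- Splits the factors by the residue of j mod 3. It turns (q⁶, q¹², q¹⁸; q¹⁸)_∞ into (q⁶; q⁶)_∞ for
the third series. -/
theorem qPochInf_trisect (a : ℂ) {q : ℂ} (hq : ‖q‖ < 1) :
    qPochInf a q = qPochInf₃ a (a * q) (a * q ^ 2) (q ^ 3) := by
  have h3 : ‖q ^ 3‖ < 1 := by rw [norm_pow]; exact pow_lt_one₀ (norm_nonneg q) hq (by norm_num)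
  have hfin : ∀ n, qPoch a q (3 * n) =
      qPoch a (q ^ 3) n * qPoch (a * q) (q ^ 3) n * qPoch (a * q ^ 2) (q ^ 3) n := by
    intro n
    induction n with
    | zero => simp [qPoch_zero]
    | succ n ih =>
      rw [show 3 * (n + 1) = 3 * n + 1 + 1 + 1 by ring]
      simp only [qPoch_succ, ih]
      ring
  refine tendsto_nhds_unique ((tendsto_qPoch a hq).comp
    (tendsto_id.const_mul_atTop' (show 0 < 3 by norm_num))) ?_
  refine Tendsto.congr (fun n => (hfin n).symm) ?_
  exact ((tendsto_qPoch _ h3).mul (tendsto_qPoch _ h3)).mul (tendsto_qPoch _ h3)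

/-- `1 / (q;q)_n`, extended by `0` to negative `n`. -/
noncomputable def invQFact (q : ℂ) (n : ℤ) : ℂ :=
  if 0 ≤ n then (qPoch q q n.toNat)⁻¹ else 0

theorem invQFact_natCast (q : ℂ) (n : ℕ) : invQFact q n = (qPoch q q n)⁻¹ := by
  simp [invQFact]

theorem invQFact_of_neg (q : ℂ) {n : ℤ} (hn : n < 0) : invQFact q n = 0 := by
  simp [invQFact, hn]

/-- Valid for every integer: at n = 0 the factor 1 - q^n vanishes, and for n < 0 both sides are 0.
Telescoping over ℤ thus needs no boundary cases. -/
theorem invQFact_sub_one {q : ℂ} (hq : ‖q‖ < 1) (n : ℤ) :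
    invQFact q (n - 1) = (1 - q ^ n) * invQFact q n := by
  rcases lt_trichotomy n 0 with h | rfl | h
  · rw [invQFact_of_neg q h, invQFact_of_neg q (by omega), mul_zero]
  · rw [invQFact_of_neg q (by omega)]; simp
  · obtain ⟨m, rfl⟩ : ∃ m : ℕ, n = (m + 1 : ℕ) := ⟨(n - 1).toNat, by omega⟩
    have h1 := one_sub_mul_pow_ne_zero hq hq m
    rw [show ((m + 1 : ℕ) : ℤ) - 1 = (m : ℕ) by push_cast; ring, invQFact_natCast,
      invQFact_natCast, qPoch_succ, zpow_natCast, pow_succ', mul_inv]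
    field_simp

theorem exists_norm_invQFact_le {q : ℂ} (hq : ‖q‖ < 1) :
    ∃ C, 0 ≤ C ∧ ∀ n, ‖invQFact q n‖ ≤ C := by
  obtain ⟨C, hC⟩ := exists_norm_inv_qPoch_le hq hq
  have h0 : 0 ≤ C := (norm_nonneg _).trans (hC 0)
  refine ⟨C, h0, fun n => ?_⟩
  unfold invQFact
  split_ifs
  · exact hC _
  · simpa using h0

theorem tendsto_invQFact {q : ℂ} (hq : ‖q‖ < 1) (c : ℤ) :
    Tendsto (fun n : ℕ => invQFact q (n + c)) atTop (𝓝 (qPochInf q q)⁻¹) := by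
  have h := (tendsto_qPoch q hq).inv₀ (qPochInf_ne_zero hq hq)
  have hc : Tendsto (fun n : ℕ => ((n : ℤ) + c).toNat) atTop atTop :=
    tendsto_atTop.2 fun b => by
      filter_upwards [eventually_ge_atTop (b + c.natAbs)] with n hn
      omega
  refine (h.comp hc).congr' ?_
  filter_upwards [eventually_ge_atTop c.natAbs] with n hn
  rw [invQFact, if_pos (by omega)]
  rfl

theorem summable_mul_invQFact_mul_invQFact (q : ℂ) {k : ℤ} (hk : 0 < k) (u v : ℤ) (c : ℤ → ℂ) :
    Summable fun i : ℤ => c i * invQFact q (u - k * i) * invQFact q (v + k * i) := by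
  refine summable_of_ne_finset_zero (s := Finset.Icc (-|v|) |u|) fun i hi => ?_
  rw [Finset.mem_Icc, not_and_or] at hi
  rcases hi with h | h
  · rw [invQFact_of_neg q (n := v + k * i), mul_zero]
    nlinarith [neg_abs_le v, le_abs_self v, abs_nonneg v]
  · rw [invQFact_of_neg q (n := u - k * i), mul_zero, zero_mul]
    nlinarith [neg_abs_le u, le_abs_self u, abs_nonneg u]

/-- Summation of a recurrence with a telescoping right-hand side. -/
theorem HasSum.of_telescoping {F F' G : ℤ → ℂ} {S a b : ℂ} (hF : HasSum F S) (hG : Summable G)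
    (ha : a ≠ 0) (h : ∀ i, a * F' i - b * F i = G (i + 1) - G i) : HasSum F' (b * S / a) := by
  obtain ⟨g, hg⟩ := hG
  have h1 : HasSum (fun i => G (i + 1)) g := (Equiv.addRight (1 : ℤ)).hasSum_iff.2 hg
  have h2 := (((h1.sub hg).add (hF.mul_left b)).div_const a)
  rw [sub_self, _root_.zero_add] at h2
  refine h2.congr_fun fun i => ?_
  rw [← h i]
  field_simp
  ring

/-! ### A `q`-Chu–Vandermonde sum and the change of base -/

/-- Induction on M for all z and c at once. For m + k = M + 1, write 1 - q^{M+1} = q^k (1 - q^m) +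
(1 - q^k). The first part reduces to M with z replaced by zq, the second to M with c replaced by cq,
and both reduced sums have the same value. -/
theorem qVandermonde {q : ℂ} (hq : ‖q‖ < 1) (M : ℕ) : ∀ z c : ℂ,
    ∑ p ∈ Finset.HasAntidiagonal.antidiagonal M, q ^ (p.1 ^ 2) * z ^ p.1 * qPoch (z * q ^ (p.1 + 1)) q p.2 *
      qPoch (c * q ^ (p.2 + 1)) q p.1 * (qPoch q q p.1)⁻¹ * (qPoch q q p.2)⁻¹ =
    qPoch (z * c * q ^ (M + 1)) q M * (qPoch q q M)⁻¹ := by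
  induction M with
  | zero => intro z c; simp [qPoch_zero]
  | succ M ih =>
    intro z c
    have hw : ∀ n, (qPoch q q (n + 1))⁻¹ * (1 - q ^ (n + 1)) = (qPoch q q n)⁻¹ := fun n => by
      have h1 := one_sub_mul_pow_ne_zero hq hq n
      rw [qPoch_succ, pow_succ', mul_inv, mul_assoc, inv_mul_cancel₀ h1, mul_one]
    have hM : 1 - q ^ (M + 1) ≠ 0 := by
      rw [pow_succ']; exact one_sub_mul_pow_ne_zero hq hq M
    set h : ℕ × ℕ → ℂ := fun p => q ^ (p.1 ^ 2) * z ^ p.1 * qPoch (z * q ^ (p.1 + 1)) q p.2 *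
      qPoch (c * q ^ (p.2 + 1)) q p.1 * (qPoch q q p.1)⁻¹ * (qPoch q q p.2)⁻¹ with hh
    have hsplit : (1 - q ^ (M + 1)) * ∑ p ∈ Finset.HasAntidiagonal.antidiagonal (M + 1), h p =
        ∑ p ∈ Finset.HasAntidiagonal.antidiagonal (M + 1), q ^ p.2 * (1 - q ^ p.1) * h p +
        ∑ p ∈ Finset.HasAntidiagonal.antidiagonal (M + 1), (1 - q ^ p.2) * h p := by
      rw [Finset.mul_sum, ← Finset.sum_add_distrib]
      refine Finset.sum_congr rfl fun p hp => ?_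
      rw [← Finset.HasAntidiagonal.mem_antidiagonal.1 hp, pow_add]
      ring
    have h1 : ∑ p ∈ Finset.HasAntidiagonal.antidiagonal (M + 1), q ^ p.2 * (1 - q ^ p.1) * h p =
        z * q ^ (M + 1) * (1 - c * q ^ (M + 1)) *
          (qPoch (z * q * c * q ^ (M + 1)) q M * (qPoch q q M)⁻¹) := by
      rw [Finset.Nat.sum_antidiagonal_succ, ← ih (z * q) c, Finset.mul_sum]
      simp only [pow_zero, sub_self, mul_zero, zero_mul, zero_add]
      refine Finset.sum_congr rfl fun p hp => ?_
      obtain ⟨m, k⟩ := p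
      rw [← Finset.HasAntidiagonal.mem_antidiagonal.1 hp]
      simp only [hh]
      rw [← hw m, qPoch_succ _ _ m]
      ring_nf
    have h2 : ∑ p ∈ Finset.HasAntidiagonal.antidiagonal (M + 1), (1 - q ^ p.2) * h p =
        (1 - z * q ^ (M + 1)) *
          (qPoch (z * (c * q) * q ^ (M + 1)) q M * (qPoch q q M)⁻¹) := by
      rw [Finset.Nat.sum_antidiagonal_succ', ← ih z (c * q), Finset.mul_sum]
      simp only [pow_zero, sub_self, zero_mul, zero_add]
      refine Finset.sum_congr rfl fun p hp => ?_
      obtain ⟨m, k⟩ := p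
      rw [← Finset.HasAntidiagonal.mem_antidiagonal.1 hp]
      simp only [hh]
      rw [← hw k, qPoch_succ _ _ k]
      ring_nf
    rw [h1, h2] at hsplit
    refine mul_left_cancel₀ hM ?_
    rw [hsplit, ← hw M, qPoch_succ (z * c * q ^ (M + 1 + 1)),
      show z * q * c * q ^ (M + 1) = z * c * q ^ (M + 1 + 1) by ring,
      show z * (c * q) * q ^ (M + 1) = z * c * q ^ (M + 1 + 1) by ring]
    ring

theorem qPoch_mul_qPoch_neg (a q : ℂ) (n : ℕ) :
    qPoch a q n * qPoch (-a) q n = qPoch (a ^ 2) (q ^ 2) n := by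
  simp only [qPoch, ← Finset.prod_mul_distrib]
  refine Finset.prod_congr rfl fun j _ => ?_
  ring

theorem sum_antidiagonal_change_base {q : ℂ} (hq : ‖q‖ < 1) (M t : ℕ) :
    ∑ p ∈ Finset.HasAntidiagonal.antidiagonal M, (-1) ^ p.1 * q ^ (p.1 ^ 2) * (qPoch (q ^ 2) (q ^ 2) p.1)⁻¹ *
      (qPoch q q p.2)⁻¹ * (qPoch q q (p.2 + t))⁻¹ =
    qPoch (-q) q (2 * M + t) *
      ((qPoch (q ^ 2) (q ^ 2) M)⁻¹ * (qPoch (q ^ 2) (q ^ 2) (M + t))⁻¹) := by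
  have hq' : ‖-q‖ < 1 := by rwa [norm_neg]
  -- With z = -1 the factor (-q^{m+1};q)_k is (-q;q)_M / (-q;q)_m, and (q;q)_m (-q;q)_m = (q²;q²)_m
  -- produces the new base.
  have hV := qVandermonde hq M (-1) (q ^ t)
  have hA := qPoch_ne_zero hq' hq M
  have hB := qPoch_ne_zero hq hq (M + t)
  have hsum : ∑ p ∈ Finset.HasAntidiagonal.antidiagonal M,
      (-1) ^ p.1 * q ^ (p.1 ^ 2) * (qPoch (q ^ 2) (q ^ 2) p.1)⁻¹ *
      (qPoch q q p.2)⁻¹ * (qPoch q q (p.2 + t))⁻¹ =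
      (qPoch (-q) q M)⁻¹ * (qPoch q q (M + t))⁻¹ *
        (qPoch (-1 * q ^ t * q ^ (M + 1)) q M * (qPoch q q M)⁻¹) := by
    rw [← hV, Finset.mul_sum]
    refine Finset.sum_congr rfl fun p hp => ?_
    obtain ⟨m, k⟩ := p
    have hm := qPoch_ne_zero hq' hq m
    have hk := qPoch_ne_zero hq hq (k + t)
    have hMt := Finset.HasAntidiagonal.mem_antidiagonal.1 hp
    simp only at hMt ⊢
    have e1 : qPoch (-q) q M = qPoch (-q) q m * qPoch (-1 * q ^ (m + 1)) q k := by
      rw [← hMt, qPoch_add]; ring_nf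
    have e2 : qPoch q q (M + t) = qPoch q q (k + t) * qPoch (q ^ t * q ^ (k + 1)) q m := by
      rw [← hMt, show m + k + t = k + t + m by ring, qPoch_add _ _ (k + t)]; ring_nf
    rw [e1] at hA
    rw [e2] at hB
    rw [e1, e2, ← qPoch_mul_qPoch_neg q q m]
    simp only [neg_one_mul] at hA ⊢
    have := right_ne_zero_of_mul hA
    have := right_ne_zero_of_mul hB
    have := qPoch_ne_zero hq hq m
    have := qPoch_ne_zero hq hq k
    field_simp
  rw [hsum, ← qPoch_mul_qPoch_neg q q M, ← qPoch_mul_qPoch_neg q q (M + t),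
    show 2 * M + t = M + t + M by ring, qPoch_add (-q)]
  have := qPoch_ne_zero hq' hq (M + t)
  have := qPoch_ne_zero hq hq M
  rw [show -1 * q ^ t * q ^ (M + 1) = -q * q ^ (M + t) by ring]
  field_simp

/-- Both sides are invariant under j ↦ -s - j, so j ≥ 0 suffices, and there a shift by j reduces to
the natural-number form. In the gap -s < j < 0 the sum, restricted to indices ≥ 0, would miss
nonzero terms; `hj` excludes that gap. -/
theorem sum_antidiagonal_change_base_int {q : ℂ} (hq : ‖q‖ < 1) (N s : ℕ) (j : ℤ)
    (hj : 0 ≤ j ∨ j + s ≤ 0) :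
    ∑ p ∈ Finset.HasAntidiagonal.antidiagonal N, (-1) ^ p.1 * q ^ (p.1 ^ 2) * (qPoch (q ^ 2) (q ^ 2) p.1)⁻¹ *
      invQFact q (p.2 - j) * invQFact q (p.2 + j + s) =
    qPoch (-q) q (2 * N + s) * (invQFact (q ^ 2) (N - j) * invQFact (q ^ 2) (N + j + s)) := by
  have key : ∀ k : ℕ, ∑ p ∈ Finset.HasAntidiagonal.antidiagonal N,
      (-1) ^ p.1 * q ^ (p.1 ^ 2) * (qPoch (q ^ 2) (q ^ 2) p.1)⁻¹ *
      invQFact q (p.2 - k) * invQFact q (p.2 + k + s) =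
      qPoch (-q) q (2 * N + s) *
        (invQFact (q ^ 2) (N - k) * invQFact (q ^ 2) (N + k + s)) := by
    intro k
    rcases lt_or_ge N k with h | h
    · rw [invQFact_of_neg _ (n := (N : ℤ) - k) (by omega), zero_mul, mul_zero]
      refine Finset.sum_eq_zero fun p hp => ?_
      have := Finset.HasAntidiagonal.mem_antidiagonal.1 hp
      rw [invQFact_of_neg _ (n := (p.2 : ℤ) - k) (by omega), mul_zero, zero_mul]
    · obtain ⟨M, rfl⟩ := Nat.exists_eq_add_of_le' h
      have h1 := sum_antidiagonal_change_base hq M (2 * k + s)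
      rw [show ((M + k : ℕ) : ℤ) - k = (M : ℕ) by push_cast; ring,
        show ((M + k : ℕ) : ℤ) + k + s = (M + (2 * k + s) : ℕ) by push_cast; ring,
        invQFact_natCast, invQFact_natCast, show 2 * (M + k) + s = 2 * M + (2 * k + s) by ring, ← h1]
      symm
      refine Finset.sum_of_injOn (fun p => (p.1, p.2 + k)) ?_ ?_ ?_ ?_
      · intro a _ b _ hab
        simp only [Prod.mk.injEq, Nat.add_right_cancel_iff] at hab
        exact Prod.ext hab.1 hab.2
      · intro p hp
        have := Finset.HasAntidiagonal.mem_antidiagonal.1 hp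
        simp only [Finset.mem_coe, Finset.HasAntidiagonal.mem_antidiagonal]
        omega
      · rintro ⟨m, r⟩ hp hn
        have := Finset.HasAntidiagonal.mem_antidiagonal.1 hp
        simp only at this
        rw [invQFact_of_neg _ (n := (r : ℤ) - k), mul_zero, zero_mul]
        by_contra hr
        refine hn ⟨(m, r - k), ?_, ?_⟩
        · simp only [Finset.mem_coe, Finset.HasAntidiagonal.mem_antidiagonal]; omega
        · simp only [Prod.mk.injEq, true_and]; omega
      · rintro ⟨m, r⟩ _
        simp only
        rw [show ((r + k : ℕ) : ℤ) - k = (r : ℕ) by push_cast; ring,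
          show ((r + k : ℕ) : ℤ) + k + s = (r + (2 * k + s) : ℕ) by push_cast; ring,
          invQFact_natCast, invQFact_natCast]
  rcases hj with hj | hj
  · lift j to ℕ using hj
    exact key j
  · obtain ⟨k, rfl⟩ : ∃ k : ℕ, j = -s - k := ⟨(-s - j).toNat, by omega⟩
    have := key k
    rw [show (N : ℤ) - (-s - k) = N + k + s by ring, show (N : ℤ) + (-s - k) + s = N - k by ring,
      mul_comm (invQFact _ _) (invQFact _ _), ← this]
    refine Finset.sum_congr rfl fun p _ => ?_
    rw [show (p.2 : ℤ) - (-s - k) = p.2 + k + s by ring,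
      show (p.2 : ℤ) + (-s - k) + s = p.2 - k by ring]
    ring

/-! ### The Durfee rectangle identity -/

theorem norm_pow_lt_one {q : ℂ} (hq : ‖q‖ < 1) {n : ℕ} (hn : n ≠ 0) : ‖q ^ n‖ < 1 := by
  rw [norm_pow]; exact pow_lt_one₀ (norm_nonneg q) hq hn

theorem norm_pow_le_pow {q : ℂ} (hq : ‖q‖ < 1) {m n : ℕ} (h : m ≤ n) : ‖q ^ n‖ ≤ ‖q‖ ^ m := by
  rw [norm_pow]; exact pow_le_pow_of_le_one (norm_nonneg q) hq.le h

/-- The sum does not depend on t, because consecutive values of t differ by a telescoping series. As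
t → ∞ only the term M = 0 survives, with limit 1/(q;q)_∞. -/
theorem hasSum_durfee {q : ℂ} (hq : ‖q‖ < 1) (t : ℕ) :
    HasSum (fun M : ℕ => q ^ (M ^ 2 + t * M) * (qPoch q q M)⁻¹ * (qPoch q q (M + t))⁻¹)
      (qPochInf q q)⁻¹ := by
  obtain ⟨C, hC⟩ := exists_norm_inv_qPoch_le hq hq
  have hC0 : 0 ≤ C := (norm_nonneg _).trans (hC 0)
  set f : ℕ → ℕ → ℂ := fun t M =>
    q ^ (M ^ 2 + t * M) * (qPoch q q M)⁻¹ * (qPoch q q (M + t))⁻¹ with hf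
  have hbound : ∀ t M, ‖f t M‖ ≤ ‖q‖ ^ M * C * C := fun t M => by
    rw [hf, norm_mul, norm_mul]
    gcongr
    · exact norm_pow_le_pow hq (by nlinarith)
    · exact hC _
    · exact hC _
  have hgeo : Summable fun M : ℕ => ‖q‖ ^ M * C * C :=
    ((summable_geometric_of_lt_one (norm_nonneg q) hq).mul_right C).mul_right C
  have hs : ∀ t, Summable (f t) := fun t => .of_norm_bounded hgeo (hbound t)
  have hstep : ∀ t, ∑' M, f t M = ∑' M, f (t + 1) M := fun t => by
    set G : ℕ → ℂ := fun M => (1 - q ^ M) * f t M with hG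
    have hG0 : G 0 = 0 := by simp [hG]
    have hGs : Summable G := by
      refine .of_norm_bounded (hgeo.mul_left 2) fun M => ?_
      rw [hG, norm_mul]
      refine mul_le_mul ?_ (hbound t M) (norm_nonneg _) (by norm_num)
      refine (norm_sub_le _ _).trans ?_
      have := norm_pow_le_pow hq (Nat.zero_le M)
      simp only [norm_one, pow_zero] at this ⊢
      linarith
    have hd : ∀ M, f t M - f (t + 1) M = G M - G (M + 1) := fun M => by
      simp only [hG, hf]
      have h1 := one_sub_mul_pow_ne_zero hq hq M
      have h2 := one_sub_mul_pow_ne_zero hq hq (M + t)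
      have h3 := qPoch_ne_zero hq hq M
      have h4 := qPoch_ne_zero hq hq (M + t)
      rw [show M + 1 + t = M + t + 1 by ring, show M + (t + 1) = M + t + 1 by ring,
        qPoch_succ, qPoch_succ, pow_succ q M, mul_comm (q ^ M) q]
      field_simp
      ring
    have h1 : ∑' M, (f t M - f (t + 1) M) = 0 := by
      simp only [hd]
      rw [Summable.tsum_sub hGs ((summable_nat_add_iff 1).2 hGs), hGs.tsum_eq_zero_add, hG0]
      ring
    rw [Summable.tsum_sub (hs t) (hs (t + 1))] at h1
    exact sub_eq_zero.1 h1
  have hconst : ∀ t u, ∑' M, f t M = ∑' M, f (t + u) M := fun t u => by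
    induction u with
    | zero => rfl
    | succ u ih => rw [ih, hstep, add_assoc]
  have hlim : Tendsto (fun u => ∑' M, f (t + u) M) atTop
      (𝓝 (∑' M, if M = 0 then (qPochInf q q)⁻¹ else 0)) := by
    refine tendsto_tsum_of_dominated_convergence hgeo (fun M => ?_)
      (Eventually.of_forall fun u M => hbound _ M)
    have hT : Tendsto (fun u => t + u) atTop atTop := tendsto_add_atTop_nat t |>.congr fun u => by
      ring
    have h2 : Tendsto (fun u : ℕ => (qPoch q q (M + u))⁻¹) atTop (𝓝 (qPochInf q q)⁻¹) :=
      ((tendsto_qPoch q hq).inv₀ (qPochInf_ne_zero hq hq)).comp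
        ((tendsto_add_atTop_nat M).congr fun u => by ring)
    refine Tendsto.comp (g := fun t => f t M) ?_ hT
    split_ifs with h
    · subst h
      simpa [hf, qPoch_zero] using h2
    · have h3 : Tendsto (fun u : ℕ => q ^ (M ^ 2 + u * M)) atTop (𝓝 0) := by
        refine squeeze_zero_norm (a := fun u => ‖q‖ ^ u)
          (fun u => norm_pow_le_pow hq ?_) (tendsto_pow_atTop_nhds_zero_of_lt_one (norm_nonneg q) hq)
        have := Nat.pos_of_ne_zero h
        nlinarith
      simpa using (h3.mul_const (qPoch q q M)⁻¹).mul h2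
  rw [tsum_ite_eq] at hlim
  have := tendsto_nhds_unique (tendsto_const_nhds.congr fun u => hconst t u) hlim
  rw [← this]
  exact (hs t).hasSum

theorem hasSum_durfee_int {q : ℂ} (hq : ‖q‖ < 1) (s : ℕ) (j : ℤ)
    (hj : 0 ≤ j ∨ j + s ≤ 0) :
    HasSum (fun N : ℕ => q ^ (N ^ 2 + s * N) * (invQFact q (N - j) * invQFact q (N + j + s)))
      (q ^ (j ^ 2 + s * j) * (qPochInf q q)⁻¹) := by
  have key : ∀ k : ℕ, HasSum
      (fun N : ℕ => q ^ (N ^ 2 + s * N) * (invQFact q (N - k) * invQFact q (N + k + s)))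
      (q ^ (k ^ 2 + s * k) * (qPochInf q q)⁻¹) := by
    intro k
    refine (Function.Injective.hasSum_iff (add_left_injective k) ?_).1 ?_
    · intro N hN
      rw [invQFact_of_neg _ (n := (N : ℤ) - k), zero_mul, mul_zero]
      by_contra h
      exact hN ⟨N - k, by simp only; omega⟩
    · refine ((hasSum_durfee hq (2 * k + s)).mul_left (q ^ (k ^ 2 + s * k))).congr_fun fun M => ?_
      simp only [Function.comp]
      rw [show ((M + k : ℕ) : ℤ) - k = (M : ℕ) by push_cast; ring,
        show ((M + k : ℕ) : ℤ) + k + s = (M + (2 * k + s) : ℕ) by push_cast; ring,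
        invQFact_natCast, invQFact_natCast]
      ring
  rcases hj with hj | hj
  · lift j to ℕ using hj
    exact_mod_cast key j
  · obtain ⟨k, rfl⟩ : ∃ k : ℕ, j = -s - k := ⟨(-s - j).toNat, by omega⟩
    have := key k
    rw [show (-s - k : ℤ) ^ 2 + s * (-s - k) = ((k ^ 2 + s * k : ℕ) : ℤ) by push_cast; ring,
      zpow_natCast]
    refine this.congr_fun fun N => ?_
    rw [show (N : ℤ) - (-s - k) = N + k + s by ring, show (N : ℤ) + (-s - k) + s = N - k by ring,
      mul_comm (invQFact _ _) (invQFact _ _)]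

/-! ### The Bailey transform with a change of base -/

theorem hasSum_bailey {q : ℂ} (hq : ‖q‖ < 1) (s : ℕ) (c : ℤ → ℂ) (β : ℕ → ℂ)
    (hc : Summable c) (hs : ∀ i : ℤ, 0 ≤ 2 * i ∨ 2 * i + s ≤ 0)
    (hβ : ∀ r : ℕ, HasSum
      (fun i : ℤ => c i * invQFact q (r - 2 * i) * invQFact q (r + 2 * i + s)) (β r))
    {S : ℂ} (hS : HasSum (fun i : ℤ => c i * (q ^ 2) ^ ((2 * i) ^ 2 + s * (2 * i))) S) :
    HasSum (fun p : ℕ × ℕ => (-1) ^ p.1 * q ^ (p.1 ^ 2) *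
        (q ^ 2) ^ ((p.1 + p.2) ^ 2 + s * (p.1 + p.2)) * β p.2 *
        (qPoch (q ^ 2) (q ^ 2) p.1)⁻¹ * (qPoch (-q) q (2 * (p.1 + p.2) + s))⁻¹)
      (S / qPochInf (q ^ 2) (q ^ 2)) := by
  have hq' : ‖-q‖ < 1 := by rwa [norm_neg]
  have hq2 : ‖q ^ 2‖ < 1 := norm_pow_lt_one hq two_ne_zero
  obtain ⟨C₁, h1, hC₁⟩ := exists_norm_invQFact_le hq
  obtain ⟨C₂, h2, hC₂⟩ := exists_norm_invQFact_le hq2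
  obtain ⟨C₃, hC₃⟩ := exists_norm_inv_qPoch_le hq' hq
  have h3 : 0 ≤ C₃ := (norm_nonneg _).trans (hC₃ 0)
  set A := ∑' i, ‖c i‖ with hA
  have hA0 : 0 ≤ A := tsum_nonneg fun i => norm_nonneg _
  have hβA : ∀ r, ‖β r‖ ≤ A * (C₁ * C₁) := fun r => by
    rw [← (hβ r).tsum_eq, hA, ← tsum_mul_right]
    refine tsum_of_norm_bounded (hc.norm.mul_right _).hasSum fun i => ?_
    rw [norm_mul, norm_mul, mul_assoc]
    gcongr
    · exact hC₁ _
    · exact hC₁ _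
  set f : ℕ × ℕ → ℂ := fun p => (-1) ^ p.1 * q ^ (p.1 ^ 2) *
        (q ^ 2) ^ ((p.1 + p.2) ^ 2 + s * (p.1 + p.2)) * β p.2 *
        (qPoch (q ^ 2) (q ^ 2) p.1)⁻¹ * (qPoch (-q) q (2 * (p.1 + p.2) + s))⁻¹ with hf
  have hgeo := summable_geometric_of_lt_one (norm_nonneg q) hq
  have hfs : Summable f := by
    -- The factor q^{n²} gives geometric decay in n and q^{2(n+r)²} gives it in r; all other factors
    -- are bounded.
    refine .of_norm_bounded ((hgeo.mul_of_nonneg hgeo (fun _ => by positivity)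
      (fun _ => by positivity)).mul_right (A * (C₁ * C₁) * C₂ * C₃)) fun p => ?_
    obtain ⟨n, r⟩ := p
    simp only [hf, norm_mul, norm_pow, norm_neg, norm_one, one_pow, one_mul]
    have e1 : ‖q‖ ^ n ^ 2 ≤ ‖q‖ ^ n :=
      pow_le_pow_of_le_one (norm_nonneg q) hq.le (by nlinarith)
    have e2 : (‖q‖ ^ 2) ^ ((n + r) ^ 2 + s * (n + r)) ≤ ‖q‖ ^ r := by
      rw [← pow_mul]
      exact pow_le_pow_of_le_one (norm_nonneg q) hq.le (by nlinarith [Nat.zero_le (s * (n + r))])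
    calc _ ≤ ‖q‖ ^ n * ‖q‖ ^ r * (A * (C₁ * C₁)) * C₂ * C₃ := by
          gcongr
          · exact hβA r
          · rw [← invQFact_natCast]; exact hC₂ _
          · exact hC₃ _
      _ = _ := by ring
  rw [← Finset.HasAntidiagonal.sigmaAntidiagonalEquivProd.hasSum_iff]
  have hfs' := Finset.HasAntidiagonal.sigmaAntidiagonalEquivProd.summable_iff.2 hfs
  refine (hfs'.hasSum_iff).2 ?_
  rw [hfs'.tsum_sigma]
  have hN : ∀ N : ℕ, ∑' p : Finset.HasAntidiagonal.antidiagonal N,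
      (f ∘ Finset.HasAntidiagonal.sigmaAntidiagonalEquivProd) ⟨N, p⟩ =
      ∑' i : ℤ, c i * ((q ^ 2) ^ (N ^ 2 + s * N) *
        (invQFact (q ^ 2) (N - 2 * i) * invQFact (q ^ 2) (N + 2 * i + s))) := by
    intro N
    have hP := qPoch_ne_zero hq' hq (2 * N + s)
    have e1 : ∑' p : Finset.HasAntidiagonal.antidiagonal N,
      (f ∘ Finset.HasAntidiagonal.sigmaAntidiagonalEquivProd) ⟨N, p⟩ =
      ∑ p ∈ Finset.HasAntidiagonal.antidiagonal N, f p :=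
      Finset.tsum_subtype _ f
    have e2 : ∀ p ∈ Finset.HasAntidiagonal.antidiagonal N, HasSum
        (fun i : ℤ => (qPoch (-q) q (2 * N + s))⁻¹ * (q ^ 2) ^ (N ^ 2 + s * N) * c i *
          ((-1) ^ p.1 * q ^ (p.1 ^ 2) * (qPoch (q ^ 2) (q ^ 2) p.1)⁻¹ *
          invQFact q (p.2 - 2 * i) * invQFact q (p.2 + 2 * i + s))) (f p) := by
      intro p hp
      have hp' := Finset.HasAntidiagonal.mem_antidiagonal.1 hp
      have := (hβ p.2).mul_left ((qPoch (-q) q (2 * N + s))⁻¹ * (q ^ 2) ^ (N ^ 2 + s * N) *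
        ((-1) ^ p.1 * q ^ (p.1 ^ 2) * (qPoch (q ^ 2) (q ^ 2) p.1)⁻¹))
      convert! this using 1
      · ext i; ring
      · simp only [hf, hp']; ring
    rw [e1, ← (hasSum_sum e2).tsum_eq]
    refine tsum_congr fun i => ?_
    rw [← Finset.mul_sum, sum_antidiagonal_change_base_int hq N s (2 * i) (hs i)]
    field_simp
  simp only [hN]
  -- Exchanging N and i leaves an inner sum over N that is the Durfee identity in base q². The
  -- exchange is dominated by ‖c i‖ times a geometric series in N.
  rw [Summable.tsum_comm]
  · rw [div_eq_mul_inv, ← hS.tsum_eq, ← tsum_mul_right]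
    refine tsum_congr fun i => ?_
    rw [tsum_mul_left, (hasSum_durfee_int hq2 s (2 * i) (hs i)).tsum_eq, mul_assoc]
  · refine .of_norm_bounded ((hc.norm.mul_of_nonneg hgeo (fun _ => by positivity)
      (fun _ => by positivity)).mul_right (C₂ * C₂)) fun p => ?_
    obtain ⟨i, N⟩ := p
    simp only [Function.uncurry, norm_mul, ← pow_mul]
    have e2 : ‖q ^ (2 * (N ^ 2 + s * N))‖ ≤ ‖q‖ ^ N :=
      norm_pow_le_pow hq (by nlinarith [Nat.zero_le (s * N)])
    calc _ ≤ ‖c i‖ * (‖q‖ ^ N * (C₂ * C₂)) := by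
          gcongr
          · exact hC₂ _
          · exact hC₂ _
      _ = _ := by ring

/-! ### The Jacobi triple product -/

theorem summable_zpow_mul_zpow_sq {p : ℂ} (h0 : p ≠ 0) (hp : ‖p‖ < 1) (x : ℂ) (hx : x ≠ 0) :
    Summable fun j : ℤ => (-1) ^ j * p ^ (j * (j - 1) / 2) * x ^ j := by
  have hnat : ∀ y : ℂ, y ≠ 0 → Summable fun n : ℕ => p ^ (n * (n - 1) / 2) * y ^ n := by
    intro y hy
    have hlim : Tendsto (fun n : ℕ => ‖p‖ ^ n * ‖y‖) atTop (𝓝 0) := by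
      simpa using (tendsto_pow_atTop_nhds_zero_of_lt_one (norm_nonneg p) hp).mul_const ‖y‖
    refine summable_of_ratio_test_tendsto_lt_one (l := 0) one_pos
      (Eventually.of_forall fun n => mul_ne_zero (pow_ne_zero _ h0) (pow_ne_zero _ hy))
      (hlim.congr fun n => ?_)
    have e : (n + 1) * (n + 1 - 1) / 2 = n * (n - 1) / 2 + n := by
      rw [← Nat.choose_two_right, ← Nat.choose_two_right, Nat.choose_succ_succ', add_comm]; simp
    have := norm_ne_zero_iff.2 h0
    have := norm_ne_zero_iff.2 hy
    rw [e, ← norm_div, ← norm_pow, ← norm_mul]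
    congr 1
    field_simp
    ring
  refine summable_int_iff_summable_nat_and_neg.2 ⟨?_, ?_⟩
  · refine Summable.of_norm ((hnat x hx).norm.congr fun n => ?_)
    simp only [norm_mul, norm_zpow, norm_neg, norm_one, zpow_natCast, norm_pow]
    rw [← Nat.choose_two_right, ← zpow_natCast]
    congr 1
    rcases n with _ | n
    · simp
    · rw [Nat.choose_two_right]; push_cast; simp
  · refine Summable.of_norm ((hnat (p * x⁻¹) (mul_ne_zero h0 (inv_ne_zero hx))).norm.congr
      fun n => ?_)
    simp only [norm_mul, norm_zpow, norm_neg, norm_one, norm_pow, mul_pow,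
      norm_inv, zpow_neg, zpow_natCast, inv_pow]
    rw [← mul_assoc, ← pow_add]
    rw [← zpow_natCast]
    congr 1
    rcases n with _ | n
    · simp
    · rw [show -((n + 1 : ℕ) : ℤ) * (-((n + 1 : ℕ) : ℤ) - 1) = (n + 1) * n + (n + 1) * 2 by
        push_cast; ring, Int.add_mul_ediv_right _ _ two_ne_zero]
      push_cast; simp

theorem jacobi_exponent_succ (j : ℤ) : (j + 1) * (j + 1 - 1) / 2 = j * (j - 1) / 2 + j := by
  rw [show (j + 1) * (j + 1 - 1) = j * (j - 1) + j * 2 by ring,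
    Int.add_mul_ediv_right _ _ two_ne_zero]

/-- A finite form of the triple product. Consecutive n are linked by a first-order recurrence whose
error is G(j+1) - G(j). Every term is a rational multiple of one common summand, so the certificate
is checked by field algebra. -/
theorem hasSum_finite_jacobi {p : ℂ} (h0 : p ≠ 0) (hp : ‖p‖ < 1) (x : ℂ) (hx : x ≠ 0) (n : ℕ) :
    HasSum (fun j : ℤ => (-1) ^ j * p ^ (j * (j - 1) / 2) * x ^ j *
        invQFact p (n - j) * invQFact p (n + j))
      (qPoch x p n * qPoch (p / x) p n * (qPoch p p (2 * n))⁻¹) := by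
  have hsupp : ∀ (u v : ℤ) (c : ℤ → ℂ),
      Summable fun j : ℤ => c j * invQFact p (u - j) * invQFact p (v + j) := fun u v c => by
    simpa using summable_mul_invQFact_mul_invQFact p one_pos u v c
  induction n with
  | zero =>
    have := hasSum_single (f := fun j : ℤ => (-1) ^ j * p ^ (j * (j - 1) / 2) * x ^ j *
        invQFact p ((0 : ℕ) - j) * invQFact p ((0 : ℕ) + j)) 0 fun j hj => by
      rcases lt_or_gt_of_ne hj with h | h
      · rw [invQFact_of_neg p (n := (0 : ℕ) + j) (by simpa using h), mul_zero]
      · rw [invQFact_of_neg p (n := (0 : ℕ) - j) (by simpa using h), mul_zero, zero_mul]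
    simpa [qPoch_zero, invQFact] using this
  | succ n ih =>
    have ha : (1 - p ^ (2 * n + 1)) * (1 - p ^ (2 * n + 2)) ≠ 0 := by
      rw [pow_succ' p (2 * n), show 2 * n + 2 = 2 * n + 1 + 1 by ring, pow_succ' p (2 * n + 1)]
      exact mul_ne_zero (one_sub_mul_pow_ne_zero hp hp _) (one_sub_mul_pow_ne_zero hp hp _)
    have hval : (1 - x * p ^ n) * (1 - p / x * p ^ n) *
        (qPoch x p n * qPoch (p / x) p n * (qPoch p p (2 * n))⁻¹) /
        ((1 - p ^ (2 * n + 1)) * (1 - p ^ (2 * n + 2))) =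
        qPoch x p (n + 1) * qPoch (p / x) p (n + 1) * (qPoch p p (2 * (n + 1)))⁻¹ := by
      rw [show 2 * (n + 1) = 2 * n + 1 + 1 by ring]
      simp only [qPoch_succ]
      rw [← pow_succ' p (2 * n), ← pow_succ' p (2 * n + 1), div_eq_mul_inv, mul_inv, mul_inv,
        mul_inv]
      ring
    rw [← hval]
    refine ih.of_telescoping (G := fun j : ℤ =>
      (-(p ^ n * p * (1 - x * p ^ n) / x) - p ^ n * p * (1 - p ^ n * p / x) / p ^ j) *
        ((-1) ^ j * p ^ (j * (j - 1) / 2) * x ^ j) *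
        invQFact p ((n + 1 : ℤ) - j) * invQFact p (n + j)) (hsupp _ _ _) ha fun j => ?_
    have w1 := invQFact_sub_one hp ((n + 1 : ℤ) - j)
    have w2 := invQFact_sub_one hp ((n + 1 : ℤ) + j)
    rw [show (n + 1 : ℤ) - j - 1 = n - j by ring] at w1
    rw [show (n + 1 : ℤ) + j - 1 = n + j by ring] at w2
    rw [show (n + 1 : ℤ) - (j + 1) = n - j by ring, show (n : ℤ) + (j + 1) = n + 1 + j by ring,
      jacobi_exponent_succ]
    push_cast
    rw [w1, w2, zpow_sub₀ h0, zpow_add₀ h0 (n + 1 : ℤ) j, zpow_add₀ h0 (j * (j - 1) / 2) j,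
      zpow_add₀ h0 n 1, zpow_add₀ h0 j 1, zpow_add₀ hx j 1, zpow_add₀ (by norm_num) j 1]
    simp only [zpow_natCast, zpow_one]
    have hy : p ^ j ≠ 0 := zpow_ne_zero _ h0
    generalize p ^ j = y at *
    generalize p ^ (j * (j - 1) / 2) = e1
    generalize (-1 : ℂ) ^ j = e2
    generalize x ^ j = e3
    field_simp
    ring

/-- The Jacobi triple product identity. -/
theorem hasSum_jacobi_triple_product {p : ℂ} (h0 : p ≠ 0) (hp : ‖p‖ < 1) (x : ℂ) (hx : x ≠ 0) :
    HasSum (fun j : ℤ => (-1) ^ j * p ^ (j * (j - 1) / 2) * x ^ j)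
      (qPochInf₃ x (p / x) p p) := by
  have hs := summable_zpow_mul_zpow_sq h0 hp x hx
  have hP := qPochInf_ne_zero hp hp
  obtain ⟨C, hC0, hC⟩ := exists_norm_invQFact_le hp
  have hlim := tendsto_tsum_of_dominated_convergence (𝓕 := atTop)
    (f := fun (n : ℕ) (j : ℤ) => (-1) ^ j * p ^ (j * (j - 1) / 2) * x ^ j *
      invQFact p (n - j) * invQFact p (n + j))
    (g := fun j : ℤ => (-1) ^ j * p ^ (j * (j - 1) / 2) * x ^ j *
      (qPochInf p p)⁻¹ * (qPochInf p p)⁻¹)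
    ((hs.norm.mul_right C).mul_right C)
    (fun j => (tendsto_const_nhds.mul (by simpa [sub_eq_add_neg] using tendsto_invQFact hp (-j))).mul
      (tendsto_invQFact hp j))
    (Eventually.of_forall fun n j => by
      rw [norm_mul, norm_mul _ (invQFact p (n - j))]
      gcongr
      · exact hC _
      · exact hC _)
  simp only [fun n : ℕ => (hasSum_finite_jacobi h0 hp x hx n).tsum_eq] at hlim
  have hlim' := ((tendsto_qPoch x hp).mul (tendsto_qPoch (p / x) hp)).mul
    (((tendsto_qPoch p hp).inv₀ hP).comp (tendsto_id.const_mul_atTop' (show 0 < 2 by norm_num)))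
  have := tendsto_nhds_unique hlim hlim'
  rw [tsum_mul_right, tsum_mul_right] at this
  have hval : ∑' j : ℤ, (-1) ^ j * p ^ (j * (j - 1) / 2) * x ^ j = qPochInf₃ x (p / x) p p := by
    rw [qPochInf₃]
    field_simp at this
    linear_combination this
  rw [← hval]
  exact hs.hasSum

/-! ### Theta series -/

theorem hasSum_theta {q : ℂ} (h0 : q ≠ 0) (hq : ‖q‖ < 1) {m : ℕ} (hm : m ≠ 0) (k : ℤ) :
    HasSum (fun i : ℤ => (-1) ^ i * q ^ (m * i ^ 2 + k * i))
      (qPochInf₃ (q ^ (m + k)) (q ^ (m - k)) (q ^ (2 * m)) (q ^ (2 * m))) := by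
  have h := hasSum_jacobi_triple_product (pow_ne_zero (2 * m) h0)
    (norm_pow_lt_one hq (by omega : 2 * m ≠ 0)) (q ^ (m + k)) (zpow_ne_zero _ h0)
  rw [← zpow_natCast, ← zpow_sub₀ h0,
    show ((2 * m : ℕ) : ℤ) - (m + k) = m - k by push_cast; ring] at h
  rw [← zpow_natCast q (2 * m)]
  refine h.congr_fun fun i => ?_
  rw [← zpow_mul, ← zpow_mul, mul_assoc, ← zpow_add₀ h0]
  congr 2
  have h2 : i * (i - 1) / 2 * 2 = i * (i - 1) := Int.ediv_mul_cancel (Int.even_mul_pred_self i).two_dvd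
  push_cast
  linear_combination (-(m : ℤ)) * h2

theorem HasSum.theta_reflect {q S : ℂ} (m k : ℤ)
    (h : HasSum (fun i : ℤ => (-1) ^ i * q ^ (m * i ^ 2 + k * i)) S) :
    HasSum (fun i : ℤ => (-1) ^ i * q ^ (m * i ^ 2 + (2 * m - k) * i + (m - k))) (-S) := by
  rw [← (Equiv.subLeft (-1 : ℤ)).hasSum_iff]
  refine h.neg.congr_fun fun i => ?_
  simp only [Function.comp, Equiv.subLeft_apply]
  rw [zpow_sub₀ (by norm_num), show m * (-1 - i) ^ 2 + (2 * m - k) * (-1 - i) + (m - k) =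
    m * i ^ 2 + k * i by ring]
  rcases Int.even_or_odd i with hi | hi <;> simp [hi.neg_one_zpow]

/-! ### Bailey pairs -/

/-- The coefficients of the Bailey pairs relative to `1`. -/
noncomputable def baileyCoeff₁ (q : ℂ) (k i : ℤ) : ℂ :=
  ((-1) ^ i * q ^ (i ^ 2 - k * i) + (-1) ^ i * q ^ (i ^ 2 + k * i)) / 2

/-- The coefficients of the Bailey pairs relative to `q²`. -/
noncomputable def baileyCoeff₂ (q : ℂ) (k i : ℤ) : ℂ :=
  ((-1) ^ i * q ^ (i ^ 2 - k * i) - (-1) ^ i * q ^ (i ^ 2 + (2 + k) * i + (1 + k))) / 2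

theorem baileyCoeff₁_one {q : ℂ} (h0 : q ≠ 0) (i : ℤ) :
    baileyCoeff₁ q 1 i = (-1) ^ i * q ^ (i ^ 2 - i) * (1 + q ^ (2 * i)) / 2 := by
  rw [baileyCoeff₁, one_mul, show i ^ 2 + i = i ^ 2 - i + 2 * i by ring, zpow_add₀ h0]
  ring

theorem baileyCoeff₁_three {q : ℂ} (h0 : q ≠ 0) (i : ℤ) :
    baileyCoeff₁ q 3 i = baileyCoeff₁ q 1 i * (q ^ (2 * i) + (q ^ (2 * i))⁻¹ - 1) := by
  have hx : q ^ (2 * i) ≠ 0 := zpow_ne_zero _ h0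
  rw [baileyCoeff₁_one h0, baileyCoeff₁, show i ^ 2 - 3 * i = i ^ 2 - i - 2 * i by ring,
    show i ^ 2 + 3 * i = i ^ 2 - i + 2 * i + 2 * i by ring, zpow_sub₀ h0 (i ^ 2 - i) (2 * i),
    zpow_add₀ h0 _ (2 * i), zpow_add₀ h0 _ (2 * i)]
  field_simp
  ring

theorem baileyCoeff₂_one {q : ℂ} (h0 : q ≠ 0) (i : ℤ) :
    baileyCoeff₂ q 1 i = (-1) ^ i * q ^ (i ^ 2 - i) * (1 - q ^ 2 * (q ^ (2 * i)) ^ 2) / 2 := by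
  rw [baileyCoeff₂, one_mul, show i ^ 2 + (2 + 1) * i + (1 + 1) = i ^ 2 - i + (2 * i + 2 * i) + 2 by
    ring, zpow_add₀ h0, zpow_add₀ h0, zpow_add₀ h0 (2 * i)]
  norm_cast
  ring

theorem baileyCoeff₂_three {q : ℂ} (h0 : q ≠ 0) (i : ℤ) :
    baileyCoeff₂ q 3 i = baileyCoeff₂ q 1 i * ((q ^ (2 * i))⁻¹ + q ^ 2 * q ^ (2 * i)) := by
  have hx : q ^ (2 * i) ≠ 0 := zpow_ne_zero _ h0
  rw [baileyCoeff₂_one h0, baileyCoeff₂, show i ^ 2 - 3 * i = i ^ 2 - i - 2 * i by ring,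
    show i ^ 2 + (2 + 3) * i + (1 + 3) = i ^ 2 - i + 2 * i + 2 * i + 2 * i + 4 by ring,
    zpow_sub₀ h0 (i ^ 2 - i) (2 * i), zpow_add₀ h0 _ 4, zpow_add₀ h0 _ (2 * i),
    zpow_add₀ h0 _ (2 * i), zpow_add₀ h0 _ (2 * i), show (4 : ℤ) = (4 : ℕ) by rfl, zpow_natCast]
  field_simp
  ring

theorem choose_two_exponent_succ (r : ℕ) : (r + 1) * (r + 1 - 1) / 2 = r * (r - 1) / 2 + r := by
  rw [← Nat.choose_two_right, ← Nat.choose_two_right, Nat.choose_succ_succ', add_comm]; simp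

theorem summable_invQFact_mul (q : ℂ) (c : ℤ → ℂ) (u v : ℤ) :
    Summable fun i : ℤ => c i * invQFact q (u - 2 * i) * invQFact q (v + 2 * i) :=
  summable_mul_invQFact_mul_invQFact q two_pos u v c

theorem one_sub_pow_succ_ne_zero {q : ℂ} (hq : ‖q‖ < 1) (n : ℕ) : 1 - q ^ (n + 1) ≠ 0 := by
  rw [pow_succ']; exact one_sub_mul_pow_ne_zero hq hq n

theorem qPoch_self_succ (q : ℂ) (r : ℕ) :
    qPoch q q (r + 1) = qPoch q q r * (1 - q ^ (r + 1)) := by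
  rw [qPoch_succ, pow_succ']

theorem qPoch_sq_succ (q : ℂ) (r : ℕ) :
    qPoch q (q ^ 2) (r + 1) = qPoch q (q ^ 2) r * (1 - q ^ (2 * r + 1)) := by
  rw [qPoch_succ, ← pow_mul, pow_succ' q (2 * r)]

theorem hasSum_baileyPair₁ {q : ℂ} (h0 : q ≠ 0) (hq : ‖q‖ < 1) (r : ℕ) :
    HasSum (fun i : ℤ => baileyCoeff₁ q 1 i * invQFact q (r - 2 * i) * invQFact q (r + 2 * i))
      (q ^ (r * (r - 1) / 2) * (qPoch q q r)⁻¹ * (qPoch q (q ^ 2) r)⁻¹) := by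
  induction r with
  | zero =>
    have := hasSum_single (f := fun i : ℤ => baileyCoeff₁ q 1 i * invQFact q ((0 : ℕ) - 2 * i) *
        invQFact q ((0 : ℕ) + 2 * i)) 0 fun j hj => by
      rcases lt_or_gt_of_ne hj with h | h
      · rw [invQFact_of_neg q (n := (0 : ℕ) + 2 * j) (by push_cast; omega), mul_zero]
      · rw [invQFact_of_neg q (n := (0 : ℕ) - 2 * j) (by push_cast; omega), mul_zero, zero_mul]
    simpa [qPoch_zero, invQFact, baileyCoeff₁] using this
  | succ r ih =>
    have ha : (1 - q ^ (r + 1)) * (1 - q ^ (2 * r + 1)) ≠ 0 :=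
      mul_ne_zero (one_sub_pow_succ_ne_zero hq _) (one_sub_pow_succ_ne_zero hq _)
    have hval : q ^ r * (q ^ (r * (r - 1) / 2) * (qPoch q q r)⁻¹ * (qPoch q (q ^ 2) r)⁻¹) /
        ((1 - q ^ (r + 1)) * (1 - q ^ (2 * r + 1))) =
        q ^ ((r + 1) * (r + 1 - 1) / 2) * (qPoch q q (r + 1))⁻¹ * (qPoch q (q ^ 2) (r + 1))⁻¹ := by
      rw [choose_two_exponent_succ, qPoch_self_succ, qPoch_sq_succ, pow_add, div_eq_mul_inv, mul_inv, mul_inv, mul_inv]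
      ring
    rw [← hval]
    refine ih.of_telescoping (G := fun i : ℤ => (-(1 / 2) * ((-1) ^ i * q ^ (i ^ 2 - i))) *
      invQFact q ((r + 1 : ℤ) - 2 * i) * invQFact q ((r - 1 : ℤ) + 2 * i))
      (summable_invQFact_mul q _ _ _) ha fun i => ?_
    have w1 := invQFact_sub_one hq ((r + 1 : ℤ) - 2 * i)
    have w2 := invQFact_sub_one hq ((r + 1 : ℤ) + 2 * i)
    have w3 := invQFact_sub_one hq ((r : ℤ) - 2 * i)
    have w4 := invQFact_sub_one hq ((r : ℤ) + 2 * i)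
    rw [show (r + 1 : ℤ) - 2 * i - 1 = r - 2 * i by ring] at w1
    rw [show (r + 1 : ℤ) + 2 * i - 1 = r + 2 * i by ring] at w2
    rw [baileyCoeff₁_one h0, show (r + 1 : ℤ) - 2 * (i + 1) = r - 2 * i - 1 by ring,
      show (r : ℤ) - 1 + 2 * (i + 1) = r + 1 + 2 * i by ring,
      show (r : ℤ) - 1 + 2 * i = r + 2 * i - 1 by ring,
      show (i + 1) ^ 2 - (i + 1) = i ^ 2 - i + 2 * i by ring]
    push_cast
    rw [w3, w4, w1, w2]
    simp only [zpow_sub₀ h0, zpow_add₀ h0, zpow_add₀ (show (-1 : ℂ) ≠ 0 by norm_num), zpow_natCast,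
      zpow_one]
    have hy : q ^ (2 * i) ≠ 0 := zpow_ne_zero _ h0
    generalize q ^ (2 * i) = y at *
    generalize q ^ (i ^ 2) / q ^ i = d
    generalize (-1 : ℂ) ^ i = e
    field_simp
    ring

theorem hasSum_baileyPair₁_pred {q : ℂ} (h0 : q ≠ 0) (hq : ‖q‖ < 1) (r : ℕ) :
    HasSum (fun i : ℤ => baileyCoeff₁ q 1 i * invQFact q (r - 2 * i - 1) *
        invQFact q (r + 2 * i - 1))
      ((1 - q ^ r) * (q - (q ^ r) ^ 2) / q ^ r *
        (q ^ (r * (r - 1) / 2) * (qPoch q q r)⁻¹ * (qPoch q (q ^ 2) r)⁻¹)) := by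
  rcases r with _ | r
  · simp only [pow_zero, sub_self, zero_mul, zero_div]
    refine hasSum_zero.congr_fun fun i => ?_
    rcases lt_or_ge i 0 with h | h
    · rw [invQFact_of_neg q (n := ((0 : ℕ) : ℤ) + 2 * i - 1) (by push_cast; omega), mul_zero]
    · rw [invQFact_of_neg q (n := ((0 : ℕ) : ℤ) - 2 * i - 1) (by push_cast; omega), mul_zero,
        zero_mul]
  · convert! hasSum_baileyPair₁ h0 hq r using 1
    · ext i
      congr 3 <;> push_cast <;> ring
    · have h1 := one_sub_pow_succ_ne_zero hq r
      have h2 := one_sub_pow_succ_ne_zero hq (2 * r)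
      rw [choose_two_exponent_succ, qPoch_self_succ, qPoch_sq_succ, pow_add q (_ / 2),
        show q - (q ^ (r + 1)) ^ 2 = q * (1 - q ^ (2 * r + 1)) by ring, mul_inv, mul_inv]
      field_simp
      ring

theorem hasSum_baileyPair₁' {q : ℂ} (h0 : q ≠ 0) (hq : ‖q‖ < 1) (r : ℕ) :
    HasSum (fun i : ℤ => baileyCoeff₁ q 3 i * invQFact q (r - 2 * i) * invQFact q (r + 2 * i))
      (q ^ (r * (r - 1) / 2) / q ^ (2 * r) * (q ^ r + q ^ (r + 1) - q) *
        (qPoch q q r)⁻¹ * (qPoch q (q ^ 2) r)⁻¹) := by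
  have hR : q ^ r ≠ 0 := pow_ne_zero _ h0
  convert! ((hasSum_baileyPair₁ h0 hq r).mul_left ((1 + (q ^ r) ^ 2 - q ^ r) / q ^ r)).sub
    ((hasSum_baileyPair₁_pred h0 hq r).mul_left (1 / q ^ r)) using 1
  · ext i
    have hx : q ^ (2 * i) ≠ 0 := zpow_ne_zero _ h0
    rw [invQFact_sub_one hq, invQFact_sub_one hq, baileyCoeff₁_three h0, zpow_sub₀ h0,
      zpow_add₀ h0, zpow_natCast]
    field_simp
    ring
  · rw [show 2 * r = r + r by ring, pow_add, pow_succ]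
    field_simp
    ring

theorem hasSum_baileyPair₂ {q : ℂ} (h0 : q ≠ 0) (hq : ‖q‖ < 1) (r : ℕ) :
    HasSum (fun i : ℤ => baileyCoeff₂ q 1 i * invQFact q (r - 2 * i) * invQFact q (r + 2 * i + 2))
      (q ^ (r * (r - 1) / 2) * (qPoch q q r)⁻¹ * (qPoch q (q ^ 2) (r + 1))⁻¹) := by
  induction r with
  | zero =>
    have := hasSum_sum_of_ne_finset_zero (L := .unconditional ℤ)
      (f := fun i : ℤ => baileyCoeff₂ q 1 i * invQFact q ((0 : ℕ) - 2 * i) *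
        invQFact q ((0 : ℕ) + 2 * i + 2)) (s := {0, -1}) fun j hj => by
      simp only [Finset.mem_insert, Finset.mem_singleton, not_or] at hj
      rcases lt_or_gt_of_ne hj.1 with h | h
      · rw [invQFact_of_neg q (n := (0 : ℕ) + 2 * j + 2) (by push_cast; omega), mul_zero]
      · rw [invQFact_of_neg q (n := (0 : ℕ) - 2 * j) (by push_cast; omega), mul_zero, zero_mul]
    rw [Finset.sum_pair (by norm_num)] at this
    convert! this using 1
    have h1 := one_sub_pow_succ_ne_zero hq 0
    have h2 := one_sub_pow_succ_ne_zero hq 1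
    have w2 : invQFact q 2 = ((1 - q) * (1 - q ^ 2))⁻¹ := by
      rw [show (2 : ℤ) = (2 : ℕ) by rfl, invQFact_natCast, qPoch_succ, qPoch_succ, qPoch_zero]
      ring_nf
    have w0 : invQFact q 0 = 1 := by simp [invQFact, qPoch_zero]
    simp only [zero_add, pow_one] at h1
    norm_num [qPoch_zero, qPoch_succ, w2, w0, baileyCoeff₂]
    norm_cast
    field_simp
    ring
  | succ r ih =>
    have ha : (1 - q ^ (r + 1)) * (1 - q ^ (2 * r + 3)) ≠ 0 :=
      mul_ne_zero (one_sub_pow_succ_ne_zero hq _) (one_sub_pow_succ_ne_zero hq _)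
    have hval : q ^ r * (q ^ (r * (r - 1) / 2) * (qPoch q q r)⁻¹ * (qPoch q (q ^ 2) (r + 1))⁻¹) /
        ((1 - q ^ (r + 1)) * (1 - q ^ (2 * r + 3))) =
        q ^ ((r + 1) * (r + 1 - 1) / 2) * (qPoch q q (r + 1))⁻¹ *
          (qPoch q (q ^ 2) (r + 1 + 1))⁻¹ := by
      rw [choose_two_exponent_succ, qPoch_self_succ, qPoch_sq_succ q (r + 1), pow_add, div_eq_mul_inv, mul_inv, mul_inv, mul_inv]
      ring
    rw [← hval]
    refine ih.of_telescoping (G := fun i : ℤ =>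
      ((q ^ (2 * i) - 1) / 2 * ((-1) ^ i * q ^ (i ^ 2 - i))) *
      invQFact q ((r + 1 : ℤ) - 2 * i) * invQFact q ((r + 1 : ℤ) + 2 * i))
      (summable_invQFact_mul q _ _ _) ha fun i => ?_
    have w1 := invQFact_sub_one hq ((r + 1 : ℤ) - 2 * i)
    have w2 := invQFact_sub_one hq ((r + 3 : ℤ) + 2 * i)
    have w3 := invQFact_sub_one hq ((r : ℤ) - 2 * i)
    have w4 := invQFact_sub_one hq ((r + 2 : ℤ) + 2 * i)
    rw [show (r + 1 : ℤ) - 2 * i - 1 = r - 2 * i by ring] at w1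
    rw [show (r + 3 : ℤ) + 2 * i - 1 = r + 2 + 2 * i by ring] at w2
    rw [baileyCoeff₂_one h0, show (r + 1 : ℤ) - 2 * (i + 1) = r - 2 * i - 1 by ring,
      show (r : ℤ) + 1 + 2 * (i + 1) = r + 3 + 2 * i by ring,
      show (r : ℤ) + 1 + 2 * i = r + 2 + 2 * i - 1 by ring,
      show (r : ℤ) + 2 * i + 2 = r + 2 + 2 * i by ring,
      show (i + 1) ^ 2 - (i + 1) = i ^ 2 - i + 2 * i by ring,
      show ((r + 1 : ℕ) : ℤ) + 2 * i + 2 = r + 3 + 2 * i by push_cast; ring,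
      show 2 * (i + 1) = 2 * i + 2 by ring]
    push_cast
    rw [w3, w4, w1, w2]
    simp only [zpow_sub₀ h0, zpow_add₀ h0, zpow_add₀ (show (-1 : ℂ) ≠ 0 by norm_num), zpow_natCast,
      zpow_ofNat]
    have hy : q ^ (2 * i) ≠ 0 := zpow_ne_zero _ h0
    generalize q ^ (2 * i) = y at *
    generalize q ^ (i ^ 2) / q ^ i = d
    generalize (-1 : ℂ) ^ i = e
    field_simp
    ring

theorem hasSum_baileyPair₂_pred {q : ℂ} (h0 : q ≠ 0) (hq : ‖q‖ < 1) (r : ℕ) :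
    HasSum (fun i : ℤ => baileyCoeff₂ q 1 i * invQFact q (r - 2 * i - 1) *
        invQFact q (r + 2 * i + 2 - 1))
      ((1 - q ^ r) * (1 - q * (q ^ r) ^ 2) * q / q ^ r *
        (q ^ (r * (r - 1) / 2) * (qPoch q q r)⁻¹ * (qPoch q (q ^ 2) (r + 1))⁻¹)) := by
  rcases r with _ | r
  · simp only [pow_zero, sub_self, zero_mul, zero_div]
    refine hasSum_zero.congr_fun fun i => ?_
    rcases lt_or_ge i 0 with h | h
    · rw [invQFact_of_neg q (n := ((0 : ℕ) : ℤ) + 2 * i + 2 - 1) (by push_cast; omega), mul_zero]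
    · rw [invQFact_of_neg q (n := ((0 : ℕ) : ℤ) - 2 * i - 1) (by push_cast; omega), mul_zero,
        zero_mul]
  · convert! hasSum_baileyPair₂ h0 hq r using 1
    · ext i
      congr 3 <;> push_cast <;> ring
    · have h1 := one_sub_pow_succ_ne_zero hq r
      have h2 := one_sub_pow_succ_ne_zero hq (2 * r + 2)
      rw [choose_two_exponent_succ, qPoch_self_succ, qPoch_sq_succ q (r + 1), pow_add q (_ / 2),
        show 1 - q * (q ^ (r + 1)) ^ 2 = 1 - q ^ (2 * r + 2 + 1) by ring,
        show 2 * (r + 1) = 2 * r + 2 by ring, mul_inv, mul_inv]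
      field_simp
      ring

theorem hasSum_baileyPair₂' {q : ℂ} (h0 : q ≠ 0) (hq : ‖q‖ < 1) (r : ℕ) :
    HasSum (fun i : ℤ => baileyCoeff₂ q 3 i * invQFact q (r - 2 * i) * invQFact q (r + 2 * i + 2))
      (q ^ (r * (r - 1) / 2) / q ^ (2 * r) * (q ^ (2 * r + 2) - q + q ^ r + q ^ (r + 1)) *
        (qPoch q q r)⁻¹ * (qPoch q (q ^ 2) (r + 1))⁻¹) := by
  have hR : q ^ r ≠ 0 := pow_ne_zero _ h0
  convert! ((hasSum_baileyPair₂ h0 hq r).mul_left ((1 + q ^ 2 * (q ^ r) ^ 2) / q ^ r)).sub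
    ((hasSum_baileyPair₂_pred h0 hq r).mul_left (1 / q ^ r)) using 1
  · ext i
    have hx : q ^ (2 * i) ≠ 0 := zpow_ne_zero _ h0
    rw [invQFact_sub_one hq, invQFact_sub_one hq, baileyCoeff₂_three h0, zpow_sub₀ h0,
      zpow_add₀ h0, zpow_add₀ h0, zpow_natCast, zpow_ofNat]
    field_simp
    ring
  · rw [pow_add q (2 * r), show 2 * r = r + r by ring, pow_add q r r, pow_succ q r]
    field_simp
    ring

/-! ### Theta series attached to the Bailey pairs -/

theorem qPochInf₃_swap (a b c q : ℂ) : qPochInf₃ a b c q = qPochInf₃ b a c q := by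
  simp only [qPochInf₃]; ring

theorem summable_baileyCoeff₁ {q : ℂ} (h0 : q ≠ 0) (hq : ‖q‖ < 1) (k : ℤ) :
    Summable (baileyCoeff₁ q k) := by
  refine (((hasSum_theta h0 hq one_ne_zero (-k)).add
    (hasSum_theta h0 hq one_ne_zero k)).div_const 2).summable.congr fun i => ?_
  rw [baileyCoeff₁]
  ring_nf

theorem summable_baileyCoeff₂ {q : ℂ} (h0 : q ≠ 0) (hq : ‖q‖ < 1) (k : ℤ) :
    Summable (baileyCoeff₂ q k) := by
  have h := hasSum_theta h0 hq one_ne_zero (-k)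
  refine ((h.sub (h.theta_reflect)).div_const 2).summable.congr fun i => ?_
  rw [baileyCoeff₂]
  push_cast
  ring_nf

theorem hasSum_baileyCoeff₁ {q : ℂ} (h0 : q ≠ 0) (hq : ‖q‖ < 1) (k : ℤ) :
    HasSum (fun i : ℤ => baileyCoeff₁ q k i * (q ^ 2) ^ ((2 * i) ^ 2 + (0 : ℕ) * (2 * i)))
      (qPochInf₃ (q ^ (9 + k)) (q ^ (9 - k)) (q ^ 18) (q ^ 18)) := by
  have h1 := hasSum_theta h0 hq (show 9 ≠ 0 by norm_num) k
  have h2 := hasSum_theta h0 hq (show 9 ≠ 0 by norm_num) (-k)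
  rw [qPochInf₃_swap, sub_neg_eq_add, ← sub_eq_add_neg] at h2
  convert! (h2.add h1).div_const 2 using 1
  · ext i
    rw [← zpow_natCast q 2, ← zpow_mul, baileyCoeff₁, div_mul_eq_mul_div, add_mul, mul_assoc,
      mul_assoc, ← zpow_add₀ h0, ← zpow_add₀ h0]
    push_cast
    ring_nf
  · push_cast
    ring

theorem hasSum_baileyCoeff₂ {q : ℂ} (h0 : q ≠ 0) (hq : ‖q‖ < 1) (k : ℤ) :
    HasSum (fun i : ℤ => baileyCoeff₂ q k i * (q ^ 2) ^ ((2 * i) ^ 2 + (2 : ℕ) * (2 * i)))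
      (qPochInf₃ (q ^ (1 + k)) (q ^ (17 - k)) (q ^ 18) (q ^ 18)) := by
  have h := hasSum_theta h0 hq (show 9 ≠ 0 by norm_num) (8 - k)
  rw [qPochInf₃_swap] at h
  convert! (h.sub h.theta_reflect).div_const 2 using 1
  · ext i
    rw [← zpow_natCast q 2, ← zpow_mul, baileyCoeff₂, div_mul_eq_mul_div, sub_mul, mul_assoc,
      mul_assoc, ← zpow_add₀ h0, ← zpow_add₀ h0]
    push_cast
    ring_nf
  · push_cast
    ring_nf

/-! ### The double series -/

theorem exists_triangular (r : ℕ) : ∃ T, r * (r - 1) / 2 = T ∧ r ^ 2 = 2 * T + r := by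
  refine ⟨_, rfl, ?_⟩
  rw [Nat.mul_div_cancel' (Nat.even_mul_pred_self r).two_dvd]
  rcases r with _ | r
  · rfl
  · simp only [Nat.add_sub_cancel]; ring

theorem qPochInf_zero_left (q : ℂ) : qPochInf 0 q = 1 := by simp [qPochInf]

theorem hasSum_of_eq_zero {f : ℕ × ℕ → ℂ} (h0 : f (0, 0) = 1)
    (hr : ∀ r, r ≠ 0 → f (0, r) = 0) (hn : ∀ n r, n ≠ 0 → f (n, r) = 0) : HasSum f 1 := by
  rw [← h0]
  refine hasSum_single (0, 0) fun p hp => ?_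
  obtain ⟨n, r⟩ := p
  by_cases h : n = 0
  · subst h
    exact hr r fun hr0 => hp (by rw [hr0])
  · exact hn n r h

theorem mainTheorem8 (q : ℂ) (hq : ‖q‖ < 1) :
    HasSum (fun p : ℕ × ℕ =>
        let n := p.1
        let r := p.2
        (-1) ^ n * q ^ (3 * n ^ 2 + 4 * n + 4 * n * r + (5 * r ^ 2 + 7 * r) / 2) /
          (qPoch (-q) q (2 * n + 2 * r + 2) * qPoch q q r *
            qPoch q (q ^ 2) (r + 1) * qPoch (q ^ 2) (q ^ 2) n))
      (qPochInf₃ (q ^ 2) (q ^ 16) (q ^ 18) (q ^ 18) / qPochInf (q ^ 2) (q ^ 2)) ∧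
    HasSum (fun p : ℕ × ℕ =>
        let n := p.1
        let r := p.2
        (-1) ^ n * q ^ (3 * n ^ 2 + 4 * n + 4 * n * r + (5 * r ^ 2 + 3 * r) / 2) *
            (q ^ (2 * r + 2) - q + q ^ r + q ^ (r + 1)) /
          (qPoch (-q) q (2 * n + 2 * r + 2) * qPoch q q r *
            qPoch q (q ^ 2) (r + 1) * qPoch (q ^ 2) (q ^ 2) n))
      (qPochInf₃ (q ^ 4) (q ^ 14) (q ^ 18) (q ^ 18) / qPochInf (q ^ 2) (q ^ 2)) ∧
    HasSum (fun p : ℕ × ℕ =>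
        let n := p.1
        let r := p.2
        (-1) ^ n * q ^ (3 * n ^ 2 + 4 * n * r + (5 * r ^ 2 - 5 * r) / 2) *
            (q ^ r + q ^ (r + 1) - q) /
          (qPoch (-q) q (2 * n + 2 * r) * qPoch q q r *
            qPoch q (q ^ 2) r * qPoch (q ^ 2) (q ^ 2) n))
      (qPochInf (q ^ 6) (q ^ 6) / qPochInf (q ^ 2) (q ^ 2)) ∧
    HasSum (fun p : ℕ × ℕ =>
        let n := p.1
        let r := p.2
        (-1) ^ n * q ^ (3 * n ^ 2 + 4 * n * r + (5 * r ^ 2 - r) / 2) /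
          (qPoch (-q) q (2 * n + 2 * r) * qPoch q q r *
            qPoch q (q ^ 2) r * qPoch (q ^ 2) (q ^ 2) n))
      (qPochInf₃ (q ^ 8) (q ^ 10) (q ^ 18) (q ^ 18) / qPochInf (q ^ 2) (q ^ 2)) := by
  rcases eq_or_ne q 0 with rfl | h0
  · have hsq : ∀ n : ℕ, n ≠ 0 → 3 * n ^ 2 ≠ 0 := fun n hn => by positivity
    have hle : ∀ r : ℕ, r ≠ 0 → 1 ≤ r ^ 2 := fun r hr => Nat.one_le_iff_ne_zero.2 (by positivity)
    refine ⟨?_, ?_, ?_, ?_⟩ <;>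
      (simp only [qPochInf₃, ne_eq, OfNat.ofNat_ne_zero, not_false_eq_true, zero_pow,
        qPochInf_zero_left, mul_one, div_one]
       refine hasSum_of_eq_zero (by simp [qPoch]) (fun r hr => ?_) fun n r hn => ?_) <;>
      have hr' := hle r <;> simp only
    · rw [zero_pow (by have := hr' hr; omega)]; simp
    · rw [zero_pow (by have := hsq n hn; omega)]; simp
    · rw [zero_pow (by have := hr' hr; omega)]; simp
    · rw [zero_pow (by have := hsq n hn; omega)]; simp
    · rw [zero_pow hr]; simp
    · rw [zero_pow (by have := hsq n hn; omega)]; simp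
    · rw [zero_pow (by
        have : r ≤ r ^ 2 := Nat.le_self_pow two_ne_zero r
        omega)]; simp
    · rw [zero_pow (by have := hsq n hn; omega)]; simp
  have hs₁ : ∀ i : ℤ, 0 ≤ 2 * i ∨ 2 * i + (0 : ℕ) ≤ 0 := fun i => by push_cast; omega
  have hs₂ : ∀ i : ℤ, 0 ≤ 2 * i ∨ 2 * i + (2 : ℕ) ≤ 0 := fun i => by push_cast; omega
  refine ⟨?_, ?_, ?_, ?_⟩
  · have h := hasSum_bailey hq 2 _ _ (summable_baileyCoeff₂ h0 hq 1) hs₂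
      (hasSum_baileyPair₂ h0 hq) (hasSum_baileyCoeff₂ h0 hq 1)
    norm_num only [zpow_ofNat] at h
    refine h.congr_fun fun ⟨n, r⟩ => ?_
    obtain ⟨T, hT, hr⟩ := exists_triangular r
    simp only
    rw [hT, ← mul_add, show (5 * r ^ 2 + 7 * r) / 2 = 5 * T + 6 * r by omega,
      show 3 * n ^ 2 + 4 * n + 4 * n * r + (5 * T + 6 * r) =
        n ^ 2 + 2 * ((n + r) ^ 2 + 2 * (n + r)) + T by linarith,
      pow_add, pow_add, pow_mul, div_eq_mul_inv, mul_inv, mul_inv, mul_inv]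
    ring
  · have h := hasSum_bailey hq 2 _ _ (summable_baileyCoeff₂ h0 hq 3) hs₂
      (hasSum_baileyPair₂' h0 hq) (hasSum_baileyCoeff₂ h0 hq 3)
    norm_num only [zpow_ofNat] at h
    refine h.congr_fun fun ⟨n, r⟩ => ?_
    obtain ⟨T, hT, hr⟩ := exists_triangular r
    simp only
    have hE : q ^ (3 * n ^ 2 + 4 * n + 4 * n * r + (5 * T + 4 * r)) =
        q ^ (n ^ 2) * (q ^ 2) ^ ((n + r) ^ 2 + 2 * (n + r)) * (q ^ T / q ^ (2 * r)) := by
      rw [← mul_div_assoc, eq_div_iff (pow_ne_zero _ h0), ← pow_mul, ← pow_add, ← pow_add,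
        ← pow_add]
      congr 1
      linarith
    rw [hT, ← mul_add, show (5 * r ^ 2 + 3 * r) / 2 = 5 * T + 4 * r by omega, hE,
      div_eq_mul_inv, mul_inv, mul_inv, mul_inv]
    ring
  · have h := hasSum_bailey hq 0 _ _ (summable_baileyCoeff₁ h0 hq 3) hs₁
      (fun r => by simpa using hasSum_baileyPair₁' h0 hq r) (hasSum_baileyCoeff₁ h0 hq 3)
    norm_num only [zpow_ofNat] at h
    have h6 := qPochInf_trisect (q ^ 6) (norm_pow_lt_one hq (show 6 ≠ 0 by norm_num))
    rw [← pow_mul, ← pow_mul, ← pow_add, ← pow_add] at h6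
    rw [h6, qPochInf₃_swap]
    refine h.congr_fun fun ⟨n, r⟩ => ?_
    obtain ⟨T, hT, hr⟩ := exists_triangular r
    simp only
    have hE : q ^ (3 * n ^ 2 + 4 * n * r + 5 * T) =
        q ^ (n ^ 2) * (q ^ 2) ^ ((n + r) ^ 2) * (q ^ T / q ^ (2 * r)) := by
      rw [← mul_div_assoc, eq_div_iff (pow_ne_zero _ h0), ← pow_mul, ← pow_add, ← pow_add,
        ← pow_add]
      congr 1
      linarith
    rw [hT, ← mul_add, show (5 * r ^ 2 - 5 * r) / 2 = 5 * T by omega, hE, div_eq_mul_inv, mul_inv,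
      mul_inv, mul_inv]
    simp only [zero_mul, add_zero]
    ring
  · have h := hasSum_bailey hq 0 _ _ (summable_baileyCoeff₁ h0 hq 1) hs₁
      (fun r => by simpa using hasSum_baileyPair₁ h0 hq r) (hasSum_baileyCoeff₁ h0 hq 1)
    norm_num only [zpow_ofNat] at h
    rw [qPochInf₃_swap]
    refine h.congr_fun fun ⟨n, r⟩ => ?_
    obtain ⟨T, hT, hr⟩ := exists_triangular r
    simp only
    rw [hT, ← mul_add, show (5 * r ^ 2 - r) / 2 = 5 * T + 2 * r by omega,
      show 3 * n ^ 2 + 4 * n * r + (5 * T + 2 * r) = n ^ 2 + 2 * (n + r) ^ 2 + T by linarith,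
      pow_add, pow_add, pow_mul, div_eq_mul_inv, mul_inv, mul_inv, mul_inv]
    simp only [zero_mul, add_zero]
    ring
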